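/- For integers $d \ge 1$ and real $t \ge 0$, let $I_d(t)$ denote the $(d-1)$-dimensional volume of $H \cap [0,1]^d$, where $H$ is a hyperplane of $\mathbb{R}^d$ that is orthogonal to a diagonal of the hypercube $[0,1]^d$ (a segment joining two opposite vertices) and whose Euclidean distance to the center $(1/2,\dots,1/2)$ of $[0,1]^d$ is equal to $t$; by symmetry, this volume does not depend on the choice of such an $H$. Let $$\gamma^\pm=\frac12\sqrt{1\pm\sqrt{\tfrac23}},$$ which are the non-negative roots of $1-24t^2+48t^4$. Then, for every fixed $t \ge 0$, $$\lim_{d\to\infty} d^2\bigl(I_{d+1}(t)-I_d(t)\bigr)=\frac{3\sqrt6\,\bigl(1-24t^2+48t^4\bigr)}{20\sqrt{\pi}\,e^{6t^2}}.$$ Consequently, for every large enough integer $d$ (depending on $t$), $I_{d+1}(t)-I_d(t)$ is positive when $0\le t<\gamma^-$ or $\gamma^+<t$, and negative when $\gamma^-<t<\gamma^+$. -/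

import Mathlib

open Filter Topology MeasureTheory

/-- The unit hypercube `[0,1]^d` in Euclidean space `ℝ^d`. -/
def unitCube (d : ℕ) : Set (EuclideanSpace ℝ (Fin d)) :=
  {x | ∀ i, x i ∈ Set.Icc (0 : ℝ) 1}

/-- The center `(1/2, …, 1/2)` of the unit hypercube. -/
noncomputable def cubeCenter (d : ℕ) : EuclideanSpace ℝ (Fin d) :=
  WithLp.toLp 2 (fun _ => (1 / 2 : ℝ))

/-- The vertices of the unit hypercube. -/
def IsCubeVertex {d : ℕ} (v : EuclideanSpace ℝ (Fin d)) : Prop :=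
  ∀ i, v i = 0 ∨ v i = 1

/-- `H` is a hyperplane of `ℝ^d` (with `d ≥ 1`) that is orthogonal to a diagonal of the unit
hypercube and whose distance to the center of the hypercube is `t`. The diagonals of the hypercube
are the segments that join a vertex `v` to the opposite vertex; they pass through the center, so
that the diagonal at `v` is directed by `v - cubeCenter d`. -/
structure IsDiagonalHyperplane {d : ℕ} (t : ℝ)
    (H : AffineSubspace ℝ (EuclideanSpace ℝ (Fin d))) : Prop where
  nonempty : (H : Set (EuclideanSpace ℝ (Fin d))).Nonempty
  orthogonal : ∃ v : EuclideanSpace ℝ (Fin d), IsCubeVertex v ∧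
    H.direction = (Submodule.span ℝ {v - cubeCenter d})ᗮ
  infDist_center : Metric.infDist (cubeCenter d) (H : Set (EuclideanSpace ℝ (Fin d))) = t

/-- The `(d-1)`-dimensional volume of `H ∩ [0,1]^d`, where `μHE[k]` is the `k`-dimensional
Hausdorff measure normalized to agree with Lebesgue measure on `k`-dimensional subspaces. -/
noncomputable def sectionVolume {d : ℕ} (H : AffineSubspace ℝ (EuclideanSpace ℝ (Fin d))) : ℝ :=
  (μHE[d - 1] ((H : Set (EuclideanSpace ℝ (Fin d))) ∩ unitCube d)).toReal

/-- The smaller non-negative root of `1 - 24 t ^ 2 + 48 t ^ 4`. -/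
noncomputable def gammaMinus : ℝ := (1 / 2) * √(1 - √(2 / 3))

/-- The larger non-negative root of `1 - 24 t ^ 2 + 48 t ^ 4`. -/
noncomputable def gammaPlus : ℝ := (1 / 2) * √(1 + √(2 / 3))

/-! The volume of the slice at signed distance `s` from the center, as a function of `s`, is the
density of `⟨e, Y⟩` for `Y` uniform on the centered cube and `e` a unit vector along a diagonal. Its
Fourier transform factors over the coordinates into a `d`-th power of `sinc`, and inversion gives
the section volume as `π⁻¹ ∫ sinc (v / √d) ^ d * cos (2 t v) dv` (`volume_cubeSlice_eq_integral`,
`IsDiagonalHyperplane.sectionVolume_eq_integral`).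

Since `log (sinc u) = -u²/6 - u⁴/180 - u⁶/2835 + O(u⁸)`, the exponent `d * log (sinc (v / √d))`
tends to `-v²/6`, and its increment from `d` to `d + 1` is `v⁴ / (180 d²) + O(d⁻³)` for fixed `v`.
So `d²` times the difference of integrands tends to `(v⁴/180) exp (-v²/6) cos (2 t v)`. Dominated
convergence (`tendsto_sq_mul_integral_sinc_pow_sub`) uses a Gaussian bound for `|v| ≤ √d` and
exponential smallness in `d` beyond. The limiting integral is a Gaussian moment, which produces the
quartic in `t`; the sign of the limit then decides the monotonicity. -/

/-! ### Slices of the cube: measurability, continuity, Fubini. -/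

/-- The unit hypercube translated so that its center is the origin. -/
def centeredCube (d : ℕ) : Set (EuclideanSpace ℝ (Fin d)) :=
  {y | ∀ i, |y i| ≤ 1 / 2}

/-- The section of the centered hypercube by the hyperplane orthogonal to `e` through `s • e`,
as a subset of the orthogonal complement of `e`. -/
def cubeSlice {d : ℕ} (e : EuclideanSpace ℝ (Fin d)) (s : ℝ) :
    Set (Submodule.span ℝ {e})ᗮ :=
  {w | s • e + (w : EuclideanSpace ℝ (Fin d)) ∈ centeredCube d}

theorem measurePreserving_smul_add_orthogonal {E : Type*} [NormedAddCommGroup E]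
    [InnerProductSpace ℝ E] [FiniteDimensional ℝ E] [MeasurableSpace E] [BorelSpace E]
    {e : E} (he : ‖e‖ = 1) :
    MeasurePreserving (fun p : ℝ × (Submodule.span ℝ {e})ᗮ ↦ p.1 • e + (p.2 : E))
      (volume.prod volume) volume := by
  have h1 := (LinearIsometryEquiv.toSpanUnitSingleton e he).measurePreserving.prod
    (MeasurePreserving.id (volume : Measure (Submodule.span ℝ {e})ᗮ))
  have h2 := (WithLp.volume_preserving_toLp (Submodule.span ℝ {e})
    (Submodule.span ℝ {e})ᗮ).comp h1
  have h3 := (Submodule.span ℝ {e}).orthogonalDecomposition.symm.measurePreserving.comp h2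
  have h : (fun p : ℝ × (Submodule.span ℝ {e})ᗮ ↦ p.1 • e + (p.2 : E)) =
      (Submodule.span ℝ {e}).orthogonalDecomposition.symm ∘ WithLp.toLp 2 ∘
        Prod.map (LinearIsometryEquiv.toSpanUnitSingleton e he) id := by
    ext p
    simp
  rw [h]
  exact h3

theorem isClosed_centeredCube (d : ℕ) : IsClosed (centeredCube d) := by
  simp only [centeredCube, Set.ofPred_forall]
  exact isClosed_iInter fun i ↦ isClosed_le (by fun_prop) continuous_const

theorem norm_le_of_mem_centeredCube {d : ℕ} {y : EuclideanSpace ℝ (Fin d)}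
    (hy : y ∈ centeredCube d) : ‖y‖ ≤ √d := by
  rw [EuclideanSpace.norm_eq]
  apply Real.sqrt_le_sqrt
  calc ∑ i, ‖y i‖ ^ 2 ≤ ∑ _i : Fin d, (1 : ℝ) := by
        apply Finset.sum_le_sum
        intro i _
        have := hy i
        rw [Real.norm_eq_abs]
        nlinarith [abs_nonneg (y i)]
    _ = d := by simp

theorem volume_centeredCube_lt_top (d : ℕ) : volume (centeredCube d) < ⊤ :=
  (measure_mono fun _ hy ↦ mem_closedBall_zero_iff.2 (norm_le_of_mem_centeredCube hy)).trans_lt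
    measure_closedBall_lt_top

theorem norm_le_of_mem_cubeSlice {d : ℕ} {e : EuclideanSpace ℝ (Fin d)} {s : ℝ}
    {w : (Submodule.span ℝ {e})ᗮ} (hw : w ∈ cubeSlice e s) : ‖w‖ ≤ √d := by
  refine le_trans ?_ (norm_le_of_mem_centeredCube hw)
  have h : inner ℝ (s • e) (w : EuclideanSpace ℝ (Fin d)) = 0 :=
    Submodule.inner_right_of_mem_orthogonal
      (Submodule.smul_mem _ _ (Submodule.mem_span_singleton_self e)) w.2
  have := norm_add_sq_real (s • e) (w : EuclideanSpace ℝ (Fin d))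
  rw [h] at this
  rw [← Submodule.norm_coe]
  apply le_of_sq_le_sq _ (norm_nonneg _)
  nlinarith [sq_nonneg ‖s • e‖]

theorem norm_eq_one_of_abs_eq_inv_sqrt {d : ℕ} (hd : 1 ≤ d) {e : EuclideanSpace ℝ (Fin d)}
    (he : ∀ i, |e i| = 1 / √d) : ‖e‖ = 1 := by
  have hd' : (0 : ℝ) < d := by exact_mod_cast hd
  rw [EuclideanSpace.norm_eq]
  simp [he, hd'.ne', Real.sq_sqrt hd'.le]

/-- The coordinate is a nonzero functional on the complement of `e`: at the projection of the `i`-th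
basis vector it equals `1 - e i ^ 2`. Its level sets are thus empty or translates of a proper
subspace. -/
theorem volume_orthogonal_coord_eq_zero {d : ℕ} {e : EuclideanSpace ℝ (Fin d)}
    (he : ‖e‖ = 1) (i : Fin d) (hi : e i ^ 2 ≠ 1) (a : ℝ) :
    volume {w : (Submodule.span ℝ {e})ᗮ | (w : EuclideanSpace ℝ (Fin d)) i = a} = 0 := by
  let ℓ : (Submodule.span ℝ {e})ᗮ →ₗ[ℝ] ℝ :=
    (EuclideanSpace.proj (𝕜 := ℝ) i).toLinearMap ∘ₗ (Submodule.span ℝ {e})ᗮ.subtype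
  have hℓ (w) : ℓ w = (w : EuclideanSpace ℝ (Fin d)) i := rfl
  have hker : LinearMap.ker ℓ ≠ ⊤ := by
    intro h
    let w : EuclideanSpace ℝ (Fin d) := EuclideanSpace.single i 1 - e i • e
    have hw : w ∈ (Submodule.span ℝ {e})ᗮ := by
      rw [Submodule.mem_orthogonal_singleton_iff_inner_right]
      simp [w, inner_sub_right, inner_smul_right, he, EuclideanSpace.inner_single_right]
    have h0 : ℓ ⟨w, hw⟩ = 0 := by
      rw [← LinearMap.mem_ker, h]; trivial
    rw [hℓ] at h0
    apply hi
    simp [w] at h0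
    linarith
  by_cases hne : ∃ w₀ : (Submodule.span ℝ {e})ᗮ, ℓ w₀ = a
  · obtain ⟨w₀, hw₀⟩ := hne
    have : {w : (Submodule.span ℝ {e})ᗮ | (w : EuclideanSpace ℝ (Fin d)) i = a}
        = (fun w ↦ w + -w₀) ⁻¹' (LinearMap.ker ℓ : Set (Submodule.span ℝ {e})ᗮ) := by
      ext w
      simp only [Set.mem_ofPred_eq, Set.mem_preimage, SetLike.mem_coe, LinearMap.mem_ker, map_add,
        map_neg, hw₀, ← hℓ]
      constructor <;> intro h <;> linarith
    rw [this, measure_preimage_add_right]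
    exact Measure.addHaar_submodule _ _ hker
  · convert measure_empty (μ := (volume : Measure (Submodule.span ℝ {e})ᗮ))
    ext w
    simp only [Set.mem_ofPred_eq, Set.mem_empty_iff_false, iff_false, ← hℓ]
    exact fun h ↦ hne ⟨w, h⟩

theorem isClosed_cubeSlice {d : ℕ} (e : EuclideanSpace ℝ (Fin d)) (s : ℝ) :
    IsClosed (cubeSlice e s) :=
  (isClosed_centeredCube d).preimage (by fun_prop)

/-- Needed for pointwise Fourier inversion. The indicator of the slice is continuous in `s` at `s₀`
except for `w` with `s₀ • e + w` on a facet hyperplane, a null set. For `d = 1` the slice volume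
jumps, hence `2 ≤ d`. -/
theorem continuous_volume_cubeSlice {d : ℕ} (hd : 2 ≤ d) {e : EuclideanSpace ℝ (Fin d)}
    (he : ∀ i, |e i| = 1 / √d) : Continuous fun s ↦ volume.real (cubeSlice e s) := by
  have he1 := norm_eq_one_of_abs_eq_inv_sqrt (by omega) he
  have hd' : (2 : ℝ) ≤ d := by exact_mod_cast hd
  have hi (i) : e i ^ 2 ≠ 1 := by
    rw [← sq_abs, he, div_pow, Real.sq_sqrt (by linarith)]
    intro h
    field_simp at h
    linarith
  rw [continuous_iff_continuousAt]
  intro s₀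
  have hind (s) : volume.real (cubeSlice e s) = ∫ w, (cubeSlice e s).indicator (fun _ ↦ (1 : ℝ)) w :=
    by rw [integral_indicator_const _ (isClosed_cubeSlice e s).measurableSet]; simp
  simp only [hind]
  apply continuousAt_of_dominated (bound := (Metric.closedBall 0 √d).indicator fun _ ↦ (1 : ℝ))
  · refine Eventually.of_forall fun s ↦ ?_
    exact (aestronglyMeasurable_const.indicator (isClosed_cubeSlice e s).measurableSet)
  · refine Eventually.of_forall fun s ↦ Eventually.of_forall fun w ↦ ?_
    rw [norm_indicator_eq_indicator_norm]
    simp only [norm_one]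
    exact Set.indicator_le_indicator_of_subset
      (fun w hw ↦ mem_closedBall_zero_iff.2 (norm_le_of_mem_cubeSlice hw)) (fun _ ↦ zero_le_one) w
  · rw [integrable_indicator_iff Metric.isClosed_closedBall.measurableSet]
    exact integrableOn_const measure_closedBall_lt_top.ne
  · have h1 (i : Fin d) (a : ℝ) : ∀ᵐ w : (Submodule.span ℝ {e})ᗮ,
        (w : EuclideanSpace ℝ (Fin d)) i ≠ a :=
      measure_eq_zero_iff_ae_notMem.1 (volume_orthogonal_coord_eq_zero he1 i (hi i) a)
    have h2 : ∀ᵐ w : (Submodule.span ℝ {e})ᗮ, ∀ i,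
        |s₀ * e i + (w : EuclideanSpace ℝ (Fin d)) i| ≠ 1 / 2 := by
      rw [ae_all_iff]
      intro i
      filter_upwards [h1 i (1 / 2 - s₀ * e i), h1 i (-(1 / 2) - s₀ * e i)] with w ha hb h
      rcases eq_or_eq_neg_of_abs_eq h with h | h
      · exact ha (by linarith)
      · exact hb (by linarith)
    filter_upwards [h2] with w hw
    have hmem (s) : w ∈ cubeSlice e s ↔ ∀ i, |s * e i + (w : EuclideanSpace ℝ (Fin d)) i| ≤ 1 / 2 := by
      simp [cubeSlice, centeredCube]
    by_cases hin : ∀ i, |s₀ * e i + (w : EuclideanSpace ℝ (Fin d)) i| < 1 / 2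
    · have : ∀ᶠ s in 𝓝 s₀, ∀ i, |s * e i + (w : EuclideanSpace ℝ (Fin d)) i| < 1 / 2 := by
        rw [eventually_all]
        intro i
        exact ContinuousAt.eventually_lt (by fun_prop) continuousAt_const (hin i)
      refine (continuousAt_const (y := (1 : ℝ))).congr ?_
      filter_upwards [this] with s hs
      rw [Set.indicator_of_mem]
      exact (hmem s).2 fun i ↦ (hs i).le
    · push Not at hin
      obtain ⟨i, hi⟩ := hin
      have hi' := lt_of_le_of_ne hi (hw i).symm
      have : ∀ᶠ s in 𝓝 s₀, 1 / 2 < |s * e i + (w : EuclideanSpace ℝ (Fin d)) i| :=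
        ContinuousAt.eventually_lt continuousAt_const (by fun_prop) hi'
      refine (continuousAt_const (y := (0 : ℝ))).congr ?_
      filter_upwards [this] with s hs
      rw [Set.indicator_of_notMem]
      exact fun h ↦ absurd ((hmem s).1 h i) (not_le.2 hs)

theorem integrable_indicator_centeredCube {d : ℕ} {F : EuclideanSpace ℝ (Fin d) → ℂ}
    (hF : Continuous F) (hF1 : ∀ y, ‖F y‖ ≤ 1) :
    Integrable ((centeredCube d).indicator F) := by
  rw [integrable_indicator_iff (isClosed_centeredCube d).measurableSet]
  have : IsFiniteMeasure (volume.restrict (centeredCube d)) :=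
    ⟨by simpa using volume_centeredCube_lt_top d⟩
  exact Integrable.of_bound hF.aestronglyMeasurable 1 (Eventually.of_forall hF1)

/-- Fubini for the splitting into the line of `e` and its complement. The weight `g` is general
because two are used: `1` for integrability of the slice volume, a character for its Fourier
transform. -/
theorem integral_centeredCube_eq_integral_cubeSlice {d : ℕ} {e : EuclideanSpace ℝ (Fin d)}
    (he : ‖e‖ = 1) {g : ℝ → ℂ} (hg : Continuous g) (hg1 : ∀ s, ‖g s‖ ≤ 1) :
    Integrable (fun s ↦ g s * (volume.real (cubeSlice e s) : ℂ)) ∧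
    ∫ s, g s * (volume.real (cubeSlice e s) : ℂ) =
      ∫ y, (centeredCube d).indicator (fun y ↦ g (inner ℝ e y)) y := by
  have hmp := measurePreserving_smul_add_orthogonal he
  have hint := integrable_indicator_centeredCube (d := d)
    (F := fun y ↦ g (inner ℝ e y)) (by fun_prop) (fun y ↦ hg1 _)
  have hint2 := (hmp.integrable_comp hint.aestronglyMeasurable).2 hint
  have hslice (s : ℝ) : ∫ w : (Submodule.span ℝ {e})ᗮ,
      (centeredCube d).indicator (fun y ↦ g (inner ℝ e y)) (s • e + (w : EuclideanSpace ℝ (Fin d)))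
      = g s * (volume.real (cubeSlice e s) : ℂ) := by
    have : ∀ w : (Submodule.span ℝ {e})ᗮ, (centeredCube d).indicator (fun y ↦ g (inner ℝ e y))
        (s • e + (w : EuclideanSpace ℝ (Fin d))) = (cubeSlice e s).indicator (fun _ ↦ g s) w := by
      intro w
      have h0 : inner ℝ e (w : EuclideanSpace ℝ (Fin d)) = 0 :=
        Submodule.inner_right_of_mem_orthogonal (Submodule.mem_span_singleton_self e) w.2
      have h1 : inner ℝ e (s • e + (w : EuclideanSpace ℝ (Fin d))) = s := by
        rw [inner_add_right, h0, inner_smul_right, real_inner_self_eq_norm_sq, he]; simp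
      by_cases hw : w ∈ cubeSlice e s
      · rw [Set.indicator_of_mem hw, Set.indicator_of_mem (show _ ∈ centeredCube d from hw), h1]
      · rw [Set.indicator_of_notMem hw, Set.indicator_of_notMem (show _ ∉ centeredCube d from hw)]
    simp_rw [this]
    rw [integral_indicator_const _ (isClosed_cubeSlice e s).measurableSet, mul_comm]
    simp
  constructor
  · have := hint2.integral_prod_left
    simpa only [Function.comp_apply, hslice] using this
  · rw [← hmp.map_eq, integral_map hmp.aemeasurable (by rw [hmp.map_eq]; exact hint.1),
      ← Function.comp_def (centeredCube d |>.indicator _), integral_prod _ hint2]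
    simp only [Function.comp_apply, hslice]

/-! ### Fourier inversion and the integral formula for section volumes. -/

theorem integral_exp_mul_I_Icc_half (c : ℝ) :
    ∫ x : ℝ, (Set.Icc (-(1 / 2) : ℝ) (1 / 2)).indicator
      (fun x ↦ Complex.exp (((2 * c * x : ℝ) : ℂ) * Complex.I)) x = Real.sinc c := by
  rw [integral_indicator measurableSet_Icc, integral_Icc_eq_integral_Ioc,
    ← intervalIntegral.integral_of_le (by norm_num)]
  by_cases hc : c = 0
  · simp [hc]; norm_num
  · have h := intervalIntegral.integral_comp_mul_left
      (fun x : ℝ ↦ Complex.exp ((x : ℂ) * Complex.I)) (a := -(1 / 2)) (b := 1 / 2)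
      (c := 2 * c) (by simpa using hc)
    rw [h, show 2 * c * -(1 / 2) = -c by ring, show 2 * c * (1 / 2) = c by ring,
      integral_exp_mul_I_eq_sinc]
    rw [Complex.real_smul]
    push_cast
    have : (c : ℂ) ≠ 0 := by exact_mod_cast hc
    field_simp

theorem integral_centeredCube_exp {d : ℕ} (e : EuclideanSpace ℝ (Fin d)) (c : ℝ) :
    ∫ y, (centeredCube d).indicator
      (fun y ↦ Complex.exp (((2 * c * inner ℝ e y : ℝ) : ℂ) * Complex.I)) y =
    ∏ i, (Real.sinc (c * e i) : ℂ) := by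
  have hmp := PiLp.volume_preserving_toLp (Fin d)
  rw [← hmp.integral_comp (MeasurableEquiv.toLp 2 (Fin d → ℝ)).measurableEmbedding]
  simp_rw [← integral_exp_mul_I_Icc_half]
  rw [← integral_fintype_prod_volume_eq_prod]
  congr 1
  ext x
  by_cases hx : ∀ i, |x i| ≤ 1 / 2
  · rw [Set.indicator_of_mem (show WithLp.toLp 2 x ∈ centeredCube d from hx)]
    rw [Finset.prod_congr rfl fun i _ ↦ Set.indicator_of_mem
      (show x i ∈ Set.Icc (-(1 / 2) : ℝ) (1 / 2) from abs_le.1 (hx i)) _, ← Complex.exp_sum]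
    congr 1
    rw [← Finset.sum_mul]
    congr 1
    rw [PiLp.inner_apply, Finset.mul_sum]
    push_cast
    refine Finset.sum_congr rfl fun i _ ↦ ?_
    simp
    ring
  · rw [Set.indicator_of_notMem (show WithLp.toLp 2 x ∉ centeredCube d from hx)]
    push Not at hx
    obtain ⟨i, hi⟩ := hx
    refine (Finset.prod_eq_zero (Finset.mem_univ i) (Set.indicator_of_notMem ?_ _)).symm
    exact fun h ↦ absurd (abs_le.2 h) (not_le.2 hi)

theorem sinc_abs (x : ℝ) : Real.sinc |x| = Real.sinc x := by
  rcases abs_cases x with ⟨h, _⟩ | ⟨h, _⟩ <;> simp [h]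

/-- Adds `sinc² ≤ 1` and `x² sinc² = sin² ≤ 1`. Two factors of `sinc` therefore suffice for
integrability. -/
theorem sinc_sq_le (x : ℝ) : Real.sinc x ^ 2 ≤ 2 * (1 + x ^ 2)⁻¹ := by
  have h1 : Real.sinc x ^ 2 ≤ 1 := by
    rw [sq_le_one_iff_abs_le_one]; exact Real.abs_sinc_le_one x
  have h2 : x * Real.sinc x = Real.sin x := by
    by_cases hx : x = 0
    · simp [hx]
    · rw [Real.sinc_of_ne_zero hx]; field_simp
  have h3 : x ^ 2 * Real.sinc x ^ 2 ≤ 1 := by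
    rw [← mul_pow, h2]; exact Real.sin_sq_le_one x
  rw [← div_eq_mul_inv, le_div_iff₀ (by positivity)]
  linarith

theorem abs_sinc_pow_le {d : ℕ} (hd : 2 ≤ d) (x : ℝ) :
    |Real.sinc x ^ d| ≤ 2 * (1 + x ^ 2)⁻¹ := by
  refine le_trans ?_ (sinc_sq_le x)
  rw [abs_pow, ← sq_abs (Real.sinc x)]
  exact pow_le_pow_of_le_one (abs_nonneg _) (Real.abs_sinc_le_one x) hd

theorem integrable_sinc_pow {d : ℕ} (hd : 2 ≤ d) {a : ℝ} (ha : a ≠ 0) :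
    Integrable fun x : ℝ ↦ Real.sinc (x * a) ^ d := by
  have h1 : Integrable fun x : ℝ ↦ Real.sinc x ^ d := by
    refine Integrable.mono' (integrable_inv_one_add_sq.const_mul 2)
      (Real.continuous_sinc.pow d).aestronglyMeasurable
      (Eventually.of_forall fun x ↦ ?_)
    exact abs_sinc_pow_le hd x
  exact h1.comp_mul_right' ha

theorem volume_cubeSlice_eq_integral {d : ℕ} (hd : 2 ≤ d) {e : EuclideanSpace ℝ (Fin d)}
    (he : ∀ i, |e i| = 1 / √d) (s : ℝ) :
    volume.real (cubeSlice e s) =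
      Real.pi⁻¹ * ∫ v : ℝ, Real.sinc (v / √d) ^ d * Real.cos (2 * s * v) := by
  have he1 := norm_eq_one_of_abs_eq_inv_sqrt (by omega) he
  have hd0 : (0 : ℝ) < √d := by
    rw [Real.sqrt_pos]; exact_mod_cast (by omega : 0 < d)
  let f : ℝ → ℂ := fun s ↦ (volume.real (cubeSlice e s) : ℂ)
  have hfc : Continuous f := Complex.continuous_ofReal.comp (continuous_volume_cubeSlice hd he)
  have hfi : Integrable f := by
    simpa using (integral_centeredCube_eq_integral_cubeSlice he1 (g := fun _ ↦ 1)
      continuous_const (by simp)).1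
  have hF (ξ : ℝ) : FourierTransform.fourier f ξ
      = ((Real.sinc (ξ * (Real.pi / √d)) ^ d : ℝ) : ℂ) := by
    rw [Real.fourier_real_eq_integral_exp_smul]
    simp only [smul_eq_mul]
    have h := (integral_centeredCube_eq_integral_cubeSlice he1
      (g := fun s ↦ Complex.exp (((2 * (-Real.pi * ξ) * s : ℝ) : ℂ) * Complex.I)) (by fun_prop)
      (fun s ↦ (Complex.norm_exp_ofReal_mul_I _).le)).2
    rw [integral_centeredCube_exp] at h
    convert h using 1
    · congr 1
      ext s
      rw [show -2 * Real.pi * s * ξ = 2 * (-Real.pi * ξ) * s by ring]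
    · have (i : Fin d) : Real.sinc (-Real.pi * ξ * e i) = Real.sinc (ξ * (Real.pi / √d)) := by
        rw [← sinc_abs, ← sinc_abs (ξ * _), abs_mul, he]
        congr 1
        rw [abs_mul, abs_mul, abs_neg, abs_div, abs_of_pos hd0]
        ring
      rw [Finset.prod_congr rfl fun i _ ↦ congrArg _ (this i)]
      simp
  have hFi : Integrable (FourierTransform.fourier f) := by
    rw [funext hF]
    exact (integrable_sinc_pow hd (by positivity)).ofReal
  have hinv := hfi.fourierInv_fourier_eq hFi (v := s) hfc.continuousAt
  rw [Real.fourierInv_eq'] at hinv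
  simp only [hF, smul_eq_mul] at hinv
  have hre := congrArg Complex.re hinv
  rw [← RCLike.re_eq_complex_re, ← integral_re] at hre
  · simp only [RCLike.re_eq_complex_re, Complex.re_mul_ofReal, Complex.exp_ofReal_mul_I_re] at hre
    change _ = volume.real (cubeSlice e s) at hre
    rw [← hre]
    -- Substitution `v = π ξ` in the inversion integral.
    have h := Measure.integral_comp_mul_right
      (fun v : ℝ ↦ Real.sinc (v / √d) ^ d * Real.cos (2 * s * v)) Real.pi
    rw [abs_of_pos (by positivity), smul_eq_mul] at h
    rw [← h]
    congr 1
    ext v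
    rw [mul_comm]
    congr 2
    · congr 1
      ring
    · simp
      ring
  · have := (integrable_sinc_pow hd (a := Real.pi / √d) (by positivity)).ofReal (𝕜 := ℂ)
    refine this.bdd_mul (c := 1) (by fun_prop) (Eventually.of_forall fun v ↦ ?_)
    exact (Complex.norm_exp_ofReal_mul_I _).le

/-- Normalizing `v - c` gives `e`, and `H` is the level set `⟨e, x - c⟩ = s`. Translation by `s • e
+ c` maps the slice isometrically onto the section, and Hausdorff measure on the `(d -
1)`-dimensional complement is Lebesgue measure. The sign of `s` is lost later, by evenness of the
cosine. -/
theorem IsDiagonalHyperplane.exists_sectionVolume_eq {d : ℕ} (hd : 1 ≤ d) {t : ℝ}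
    {H : AffineSubspace ℝ (EuclideanSpace ℝ (Fin d))} (hH : IsDiagonalHyperplane t H) :
    ∃ (e : EuclideanSpace ℝ (Fin d)) (s : ℝ), (∀ i, |e i| = 1 / √d) ∧ |s| = t ∧
      sectionVolume H = volume.real (cubeSlice e s) := by
  obtain ⟨v, hv, hdir⟩ := hH.orthogonal
  obtain ⟨p, hp⟩ := hH.nonempty
  set c := cubeCenter d with hc
  have hci (i) : c i = 1 / 2 := rfl
  have hd0 : (0 : ℝ) < √d := by
    rw [Real.sqrt_pos]; exact_mod_cast (by omega : 0 < d)
  let e : EuclideanSpace ℝ (Fin d) := (2 / √d) • (v - c)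
  have he (i) : |e i| = 1 / √d := by
    have : |v i - c i| = 1 / 2 := by
      rcases hv i with h | h <;> rw [h, hci] <;> norm_num [abs_of_pos]
    simp only [e, PiLp.smul_apply, PiLp.sub_apply, smul_eq_mul]
    rw [abs_mul, this, abs_of_pos (by positivity)]
    ring
  have he1 := norm_eq_one_of_abs_eq_inv_sqrt hd he
  have hdir' : H.direction = (Submodule.span ℝ {e})ᗮ := by
    rw [hdir, Submodule.span_singleton_smul_eq (IsUnit.mk0 _ (by positivity))]
  let s : ℝ := inner ℝ e (p - c)
  have hw₀ : (p - c) - s • e ∈ H.direction := by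
    rw [hdir', Submodule.mem_orthogonal_singleton_iff_inner_right, inner_sub_right,
      inner_smul_right, real_inner_self_eq_norm_sq, he1]
    simp [s]
  have hp₀ : s • e + c ∈ H := by
    have := AffineSubspace.vadd_mem_of_mem_direction (H.direction.neg_mem hw₀) hp
    convert this using 1
    rw [vadd_eq_add]
    abel
  have hmem (x) : x ∈ H ↔ x - (s • e + c) ∈ (Submodule.span ℝ {e})ᗮ := by
    rw [← hdir', ← vsub_eq_sub, AffineSubspace.vsub_right_mem_direction_iff_mem hp₀]
  refine ⟨e, s, he, ?_, ?_⟩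
  · rw [← hH.infDist_center]
    apply le_antisymm
    · rw [Metric.le_infDist ⟨p, hp⟩]
      intro x hx
      have h0 := (Submodule.mem_orthogonal_singleton_iff_inner_right).1 ((hmem x).1 hx)
      have h1 : inner ℝ e (x - c) = s := by
        rw [show x - c = (x - (s • e + c)) + s • e by abel, inner_add_right, h0,
          inner_smul_right, real_inner_self_eq_norm_sq, he1]
        simp
      have := abs_real_inner_le_norm e (x - c)
      rwa [h1, he1, one_mul, ← dist_eq_norm, dist_comm] at this
    · refine (Metric.infDist_le_dist_of_mem hp₀).trans ?_
      rw [dist_comm, dist_eq_norm, add_sub_cancel_right, norm_smul, he1, mul_one, Real.norm_eq_abs]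
  · let φ : (Submodule.span ℝ {e})ᗮ → EuclideanSpace ℝ (Fin d) :=
      fun w ↦ (w : EuclideanSpace ℝ (Fin d)) + (s • e + c)
    have hφ : Isometry φ := Isometry.of_dist_eq fun x y ↦ by simp [φ, Subtype.dist_eq]
    have himage : (H : Set (EuclideanSpace ℝ (Fin d))) ∩ unitCube d = φ '' cubeSlice e s := by
      have hcube (w : (Submodule.span ℝ {e})ᗮ) : φ w ∈ unitCube d ↔ w ∈ cubeSlice e s := by
        refine forall_congr' fun i ↦ ?_
        have h : φ w i = (s • e + (w : EuclideanSpace ℝ (Fin d))) i + 1 / 2 := by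
          simp only [φ, PiLp.add_apply, hci]
          ring
        rw [h, Set.mem_Icc, abs_le]
        constructor <;> rintro ⟨h1, h2⟩ <;> constructor <;> linarith
      ext x
      constructor
      · rintro ⟨hx, hx'⟩
        have : φ ⟨_, (hmem x).1 hx⟩ = x := by simp [φ]
        exact ⟨_, (hcube _).1 (by rwa [this]), this⟩
      · rintro ⟨w, hw, rfl⟩
        refine ⟨(hmem _).2 ?_, (hcube w).2 hw⟩
        simp [φ]
    have hrank : Module.finrank ℝ (Submodule.span ℝ {e})ᗮ = d - 1 := by
      have h := (Submodule.span ℝ {e}).finrank_add_finrank_orthogonal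
      rw [finrank_span_singleton (by rintro h; simp [h] at he1), finrank_euclideanSpace_fin] at h
      omega
    rw [sectionVolume, himage, hφ.euclideanHausdorffMeasure_image, ← hrank,
      InnerProductSpace.euclideanHausdorffMeasure_eq_volume]
    rfl

theorem IsDiagonalHyperplane.sectionVolume_eq_integral {d : ℕ} (hd : 2 ≤ d) {t : ℝ}
    {H : AffineSubspace ℝ (EuclideanSpace ℝ (Fin d))} (hH : IsDiagonalHyperplane t H) :
    sectionVolume H =
      Real.pi⁻¹ * ∫ v : ℝ, Real.sinc (v / √d) ^ d * Real.cos (2 * t * v) := by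
  obtain ⟨e, s, he, hs, h⟩ := hH.exists_sectionVolume_eq (by omega)
  rw [h, volume_cubeSlice_eq_integral hd he]
  congr 2
  ext v
  congr 1
  rw [← Real.cos_abs, ← Real.cos_abs (2 * t * v)]
  simp [abs_mul, ← hs]

/-! ### Taylor bounds for `sinc` and its logarithm. -/

theorem Complex.norm_sin_sub_taylor_le {x : ℂ} (hx : ‖x‖ ≤ 1) :
    ‖Complex.sin x - (x - x ^ 3 / 6 + x ^ 5 / 120 - x ^ 7 / 5040)‖ ≤ ‖x‖ ^ 9 / 100 := by
  have h1 := Complex.exp_bound (x := x * I) (by simpa) (n := 9) (by norm_num)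
  have h2 := Complex.exp_bound (x := -x * I) (by simpa) (n := 9) (by norm_num)
  have h : Complex.sin x - (x - x ^ 3 / 6 + x ^ 5 / 120 - x ^ 7 / 5040) =
      ((exp (-x * I) - ∑ m ∈ Finset.range 9, (-x * I) ^ m / m.factorial) -
         (exp (x * I) - ∑ m ∈ Finset.range 9, (x * I) ^ m / m.factorial)) * (I / 2) := by
    have e2 : I ^ 2 = -1 := I_sq
    have e3 : I ^ 3 = -I := by rw [pow_succ, e2]; ring
    have e4 : I ^ 4 = 1 := I_pow_four
    have e5 : I ^ 5 = I := by rw [pow_succ, e4]; ring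
    have e6 : I ^ 6 = -1 := by rw [pow_succ, e5, ← sq, e2]
    have e7 : I ^ 7 = -I := by rw [pow_succ, e6]; ring
    have e8 : I ^ 8 = 1 := by rw [pow_succ, e7, neg_mul, ← sq, e2]; ring
    simp only [Complex.sin, Finset.sum_range_succ, Nat.factorial, mul_pow, e2, e3, e4, e5, e6, e7,
      e8]
    push_cast
    simp only [Finset.range_zero, Finset.sum_empty]
    ring_nf
    simp only [e2]
    ring
  have hI : ‖I / 2‖ = 1 / 2 := by simp
  rw [h, norm_mul, hI]
  have h3 := norm_sub_le (exp (-x * I) - ∑ m ∈ Finset.range 9, (-x * I) ^ m / m.factorial)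
    (exp (x * I) - ∑ m ∈ Finset.range 9, (x * I) ^ m / m.factorial)
  have h4 : ‖x * I‖ = ‖x‖ := by simp
  have h5 : ‖-x * I‖ = ‖x‖ := by simp
  rw [h4] at h1
  rw [h5] at h2
  -- The remainder constant of `Complex.exp_bound` is `10 / (9! * 9)`, far below `1 / 100`.
  have h6 : ‖x‖ ^ 9 * (((9 : ℕ).succ : ℝ) * (((9 : ℕ).factorial : ℝ) * (9 : ℕ))⁻¹) ≤
      ‖x‖ ^ 9 * (1 / 100) := by
    gcongr
    norm_num [Nat.factorial]
  linarith

theorem Real.abs_sin_sub_taylor_le {x : ℝ} (hx : |x| ≤ 1) :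
    |Real.sin x - (x - x ^ 3 / 6 + x ^ 5 / 120 - x ^ 7 / 5040)| ≤ |x| ^ 9 / 100 := by
  have := Complex.norm_sin_sub_taylor_le (x := (x : ℂ)) (by simpa)
  rw [Complex.norm_real, Real.norm_eq_abs] at this
  rw [← Real.norm_eq_abs, ← Complex.norm_real]
  push_cast
  exact this

theorem exists_sinc_eq_taylor {u : ℝ} (hu : |u| ≤ 1) :
    ∃ q : ℝ, |q| ≤ 1 / 100 ∧
      Real.sinc u = 1 - (u ^ 2 / 6 - (u ^ 2) ^ 2 / 120 + (u ^ 2) ^ 3 / 5040 + q * (u ^ 2) ^ 4) := by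
  by_cases h0 : u = 0
  · exact ⟨0, by norm_num, by simp [h0]⟩
  · refine ⟨-((Real.sin u - (u - u ^ 3 / 6 + u ^ 5 / 120 - u ^ 7 / 5040)) / u ^ 9), ?_, ?_⟩
    · rw [abs_neg, abs_div, abs_pow, div_le_iff₀ (by positivity)]
      linarith [Real.abs_sin_sub_taylor_le hu]
    · rw [Real.sinc_of_ne_zero h0]
      field_simp
      ring

theorem sinc_le_one_sub {u : ℝ} (hu : |u| ≤ 1) : Real.sinc u ≤ 1 - u ^ 2 / 8 := by
  obtain ⟨q, hq, h⟩ := exists_sinc_eq_taylor hu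
  have hz1 : u ^ 2 ≤ 1 := (sq_le_one_iff_abs_le_one u).2 hu
  rw [h]
  set z := u ^ 2
  have hz0 : 0 ≤ z := by positivity
  have h1 : z ^ 2 ≤ z := by nlinarith
  have h3 : 0 ≤ z ^ 3 := by positivity
  have h4 : |q * z ^ 4| ≤ 1 / 100 * z := by
    rw [abs_mul, abs_of_nonneg (by positivity : 0 ≤ z ^ 4)]
    exact mul_le_mul hq (pow_le_of_le_one hz0 hz1 (by norm_num)) (by positivity) (by norm_num)
  linarith [neg_le_of_abs_le h4]

theorem half_le_sinc {u : ℝ} (hu : |u| ≤ 1) : 1 / 2 ≤ Real.sinc u := by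
  obtain ⟨q, hq, h⟩ := exists_sinc_eq_taylor hu
  have hz1 : u ^ 2 ≤ 1 := (sq_le_one_iff_abs_le_one u).2 hu
  rw [h]
  set z := u ^ 2
  have hz0 : 0 ≤ z := by positivity
  have h2 : 0 ≤ z ^ 2 := by positivity
  have h3 : z ^ 3 ≤ 1 := pow_le_one₀ hz0 hz1
  have h4 : |q * z ^ 4| ≤ 1 / 100 * 1 := by
    rw [abs_mul, abs_of_nonneg (by positivity : 0 ≤ z ^ 4)]
    exact mul_le_mul hq (pow_le_one₀ hz0 hz1) (by positivity) (by norm_num)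
  linarith [le_of_abs_le h4]

theorem log_sinc_le {u : ℝ} (hu : |u| ≤ 1) : Real.log (Real.sinc u) ≤ -(u ^ 2 / 8) := by
  have := Real.log_le_sub_one_of_pos (by linarith [half_le_sinc hu] : 0 < Real.sinc u)
  linarith [sinc_le_one_sub hu]

/-- On `[1/2, 1]` the bound `1 - u²/8` gives `31/32`; on `[1, 2]` halve the argument using `sinc u =
sinc (u/2) cos (u/2)`; beyond `2` use `1 / |u|`. -/
theorem abs_sinc_le_of_half_le {u : ℝ} (hu : 1 / 2 ≤ |u|) : |Real.sinc u| ≤ 31 / 32 := by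
  have hone (w : ℝ) (h1 : 1 / 2 ≤ |w|) (h2 : |w| ≤ 1) : |Real.sinc w| ≤ 31 / 32 := by
    rw [abs_of_nonneg (by linarith [half_le_sinc h2])]
    have := sinc_le_one_sub h2
    rw [← sq_abs] at this
    nlinarith
  rcases le_total |u| 1 with h | h
  · exact hone u hu h
  have h0 : u ≠ 0 := by rintro rfl; simp at hu; linarith
  rcases le_total |u| 2 with h2 | h2
  · have := hone (u / 2) (by rw [abs_div, abs_two]; linarith) (by rw [abs_div, abs_two]; linarith)
    have hdouble : Real.sinc u = Real.sinc (u / 2) * Real.cos (u / 2) := by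
      rw [Real.sinc_of_ne_zero h0, Real.sinc_of_ne_zero (by simpa using h0)]
      nth_rewrite 1 [show u = 2 * (u / 2) by ring]
      rw [Real.sin_two_mul]
      field_simp
    rw [hdouble, abs_mul]
    exact (mul_le_of_le_one_right (abs_nonneg _) (Real.abs_cos_le_one _)).trans this
  · rw [Real.sinc_of_ne_zero h0, abs_div, div_le_iff₀ (by positivity)]
    linarith [Real.abs_sin_le_one u]

theorem exists_abs_log_sinc_add_le : ∃ K : ℝ, 0 ≤ K ∧ ∀ u : ℝ, |u| ≤ 1 →
    |Real.log (Real.sinc u) + (u ^ 2 / 6 + (u ^ 2) ^ 2 / 180 + (u ^ 2) ^ 3 / 2835)| ≤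
      K * (u ^ 2) ^ 4 := by
  let a : ℝ × ℝ → ℝ := fun p ↦ 1 / 6 - p.1 / 120 + p.1 ^ 2 / 5040 + p.2 * p.1 ^ 3
  -- With `z = u²` and `y = 1 - sinc u = z * a (z, q)`, `R` is what remains of `y + y²/2 + y³/3`
  -- after removing the terms up to `z³` and dividing by `z⁴`. Compactness bounds it uniformly in
  -- the Taylor remainder `q`.
  let R : ℝ × ℝ → ℝ := fun p ↦
    (-11/67200) + p.2 + (1/64800)*p.1 + (1/6)*p.1*p.2 + (-23/31752000)*p.1^2
      + (7/360)*p.1^2*p.2 + (31/1524096000)*p.1^3 + (-13/5040)*p.1^3*p.2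
      + (-1/3048192000)*p.1^4 + (41/302400)*p.1^4*p.2 + (1/2)*p.1^4*p.2^2
      + (1/384072192000)*p.1^5 + (-1/302400)*p.1^5*p.2 + (1/6)*p.1^5*p.2^2
      + (1/25401600)*p.1^6*p.2 + (-1/120)*p.1^6*p.2^2 + (1/5040)*p.1^7*p.2^2
      + (1/3)*p.1^8*p.2^3
  obtain ⟨K, hK⟩ := (isCompact_Icc (a := ((0 : ℝ), (-1 : ℝ))) (b := (1, 1))).exists_bound_of_continuousOn
    (f := fun p ↦ |R p| + 2 * |a p| ^ 4) (by fun_prop)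
  have hK0 : 0 ≤ K := (norm_nonneg _).trans (hK (0, 0) (by simp [Prod.le_def]))
  refine ⟨K, hK0, fun u hu ↦ ?_⟩
  obtain ⟨q, hq, h⟩ := exists_sinc_eq_taylor hu
  have hz1 : u ^ 2 ≤ 1 := (sq_le_one_iff_abs_le_one u).2 hu
  have hhalf := half_le_sinc hu
  have hle := Real.sinc_le_one u
  have hz0 : 0 ≤ u ^ 2 := by positivity
  generalize u ^ 2 = z at *
  have hq' := abs_le.1 hq
  have hKz := hK (z, q) ⟨⟨hz0, by simp; linarith⟩, ⟨hz1, by simp; linarith⟩⟩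
  rw [Real.norm_of_nonneg (by positivity)] at hKz
  set y := z * a (z, q) with hy
  have hsinc : Real.sinc u = 1 - y := by
    rw [h, hy]; ring
  have hy0 : 0 ≤ y := by linarith
  have hy2 : y ≤ 1 / 2 := by linarith
  have hlog := Real.abs_log_sub_add_sum_range_le (x := y) (by rw [abs_of_nonneg hy0]; linarith) 3
  rw [← hsinc] at hlog
  have hR : (∑ i ∈ Finset.range 3, y ^ (i + 1) / ((i : ℝ) + 1)) =
      z / 6 + z ^ 2 / 180 + z ^ 3 / 2835 + R (z, q) * z ^ 4 := by
    simp only [Finset.sum_range_succ, Finset.sum_range_zero, hy, a, R]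
    push_cast
    ring
  rw [hR] at hlog
  have hlog2 : |y| ^ (3 + 1) / (1 - |y|) ≤ 2 * |a (z, q)| ^ 4 * z ^ 4 := by
    rw [div_le_iff₀ (by rw [abs_of_nonneg hy0]; linarith)]
    have : |y| ^ (3 + 1) = |a (z, q)| ^ 4 * z ^ 4 := by
      rw [hy, abs_mul, abs_of_nonneg hz0]; ring
    rw [this, abs_of_nonneg hy0]
    have h0 : 0 ≤ |a (z, q)| ^ 4 * z ^ 4 := by positivity
    nlinarith
  calc |Real.log (Real.sinc u) + (z / 6 + z ^ 2 / 180 + z ^ 3 / 2835)|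
      = |(z / 6 + z ^ 2 / 180 + z ^ 3 / 2835 + R (z, q) * z ^ 4 + Real.log (Real.sinc u))
          - R (z, q) * z ^ 4| := by congr 1; ring
    _ ≤ 2 * |a (z, q)| ^ 4 * z ^ 4 + |R (z, q)| * z ^ 4 := by
        refine (abs_sub _ _).trans (add_le_add (hlog.trans hlog2) ?_)
        rw [abs_mul, abs_of_nonneg (by positivity : 0 ≤ z ^ 4)]
    _ = (|R (z, q)| + 2 * |a (z, q)| ^ 4) * z ^ 4 := by ring
    _ ≤ K * z ^ 4 := by gcongr

/-! ### Expansion of the exponent and of its increment in `d`. -/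

/-- The logarithm of `sinc (v / √d) ^ d`. -/
noncomputable def logSincPow (d : ℕ) (v : ℝ) : ℝ := d * Real.log (Real.sinc (v / √d))

theorem abs_div_sqrt_le_one {d : ℕ} {v : ℝ} (hv : |v| ≤ √d) : |v / √d| ≤ 1 := by
  rw [abs_div, abs_of_nonneg (Real.sqrt_nonneg _)]
  exact div_le_one_of_le₀ hv (Real.sqrt_nonneg _)

theorem sinc_pow_eq_exp {d : ℕ} {v : ℝ} (hv : |v| ≤ √d) :
    Real.sinc (v / √d) ^ d = Real.exp (logSincPow d v) := by
  have := half_le_sinc (abs_div_sqrt_le_one hv)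
  rw [logSincPow, Real.exp_nat_mul, Real.exp_log (by linarith)]

theorem logSincPow_le {d : ℕ} (hd : 1 ≤ d) {v : ℝ} (hv : |v| ≤ √d) :
    logSincPow d v ≤ -(v ^ 2 / 8) := by
  have hd' : (0 : ℝ) < d := by exact_mod_cast hd
  calc logSincPow d v ≤ d * (-((v / √d) ^ 2 / 8)) := by
        unfold logSincPow
        gcongr
        exact log_sinc_le (abs_div_sqrt_le_one hv)
    _ = -(v ^ 2 / 8) := by
        rw [div_pow, Real.sq_sqrt hd'.le]
        field_simp

theorem exists_abs_logSincPow_add_le : ∃ K : ℝ, 0 ≤ K ∧ ∀ (d : ℕ) (v : ℝ), 1 ≤ d → |v| ≤ √d →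
    |logSincPow d v + (v ^ 2 / 6 + v ^ 4 / 180 / d + v ^ 6 / 2835 / d ^ 2)| ≤
      K * v ^ 8 / d ^ 3 := by
  obtain ⟨K, hK0, hK⟩ := exists_abs_log_sinc_add_le
  refine ⟨K, hK0, fun d v hd hv ↦ ?_⟩
  have hd' : (0 : ℝ) < d := by exact_mod_cast hd
  have h := hK _ (abs_div_sqrt_le_one hv)
  rw [div_pow, Real.sq_sqrt hd'.le] at h
  have h2 := mul_le_mul_of_nonneg_left h hd'.le
  rw [← abs_of_pos hd', ← abs_mul, abs_of_pos hd'] at h2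
  have e1 : d * (Real.log (Real.sinc (v / √d)) +
      (v ^ 2 / d / 6 + (v ^ 2 / d) ^ 2 / 180 + (v ^ 2 / d) ^ 3 / 2835)) =
      logSincPow d v + (v ^ 2 / 6 + v ^ 4 / 180 / d + v ^ 6 / 2835 / d ^ 2) := by
    unfold logSincPow
    field_simp
  have e2 : (d : ℝ) * (K * (v ^ 2 / d) ^ 4) = K * v ^ 8 / d ^ 3 := by
    field_simp
  rwa [e1, e2] at h2

/-- The `v⁶` term must be kept explicit: an error of order `d⁻²` would survive multiplication by
`d²`, while the explicit term has increment `O(d⁻³)`. -/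
theorem exists_abs_logSincPow_succ_sub_le : ∃ K : ℝ, 0 ≤ K ∧ ∀ (d : ℕ) (v : ℝ), 1 ≤ d → |v| ≤ √d →
    |(d : ℝ) ^ 2 * (logSincPow (d + 1) v - logSincPow d v) - v ^ 4 / 180| ≤
      (v ^ 4 + v ^ 6 + K * v ^ 8) * (2 / d) := by
  obtain ⟨K, hK0, hK⟩ := exists_abs_logSincPow_add_le
  refine ⟨K, hK0, fun d v hd hv ↦ ?_⟩
  have hd' : (1 : ℝ) ≤ d := by exact_mod_cast hd
  have h1 := hK d v hd hv
  have h2 := hK (d + 1) v (by omega) (hv.trans (Real.sqrt_le_sqrt (by simp)))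
  push_cast at h2
  set x : ℝ := (d : ℝ)
  set A := logSincPow d v + (v ^ 2 / 6 + v ^ 4 / 180 / x + v ^ 6 / 2835 / x ^ 2) with hA
  set B := logSincPow (d + 1) v +
    (v ^ 2 / 6 + v ^ 4 / 180 / (x + 1) + v ^ 6 / 2835 / (x + 1) ^ 2) with hB
  have hv4 : 0 ≤ v ^ 4 := by positivity
  have hv6 : 0 ≤ v ^ 6 := by positivity
  have hv8 : 0 ≤ v ^ 8 := by positivity
  have h2' : |B| ≤ K * v ^ 8 / x ^ 3 := h2.trans (by gcongr; linarith)
  have key : x ^ 2 * (logSincPow (d + 1) v - logSincPow d v) - v ^ 4 / 180 =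
      -(v ^ 4 / 180 / (x + 1)) + v ^ 6 / 2835 * ((2 * x + 1) / (x + 1) ^ 2) + x ^ 2 * (B - A) := by
    rw [hA, hB]
    field_simp
    ring
  have hx1 : 1 / (x + 1) ≤ 2 / x := by
    rw [div_le_div_iff₀ (by positivity) (by positivity)]; linarith
  have hx2 : (2 * x + 1) / (x + 1) ^ 2 ≤ 2 / x := by
    rw [div_le_div_iff₀ (by positivity) (by positivity)]; nlinarith
  rw [key]
  have e1 : |-(v ^ 4 / 180 / (x + 1))| ≤ v ^ 4 * (2 / x) := by
    rw [abs_neg, abs_of_nonneg (by positivity), div_eq_mul_one_div (v ^ 4 / 180)]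
    gcongr
    linarith
  have e2 : |v ^ 6 / 2835 * ((2 * x + 1) / (x + 1) ^ 2)| ≤ v ^ 6 * (2 / x) := by
    rw [abs_of_nonneg (by positivity)]
    gcongr
    linarith
  have e3 : |x ^ 2 * (B - A)| ≤ K * v ^ 8 * (2 / x) := by
    rw [abs_mul, abs_of_nonneg (by positivity)]
    calc x ^ 2 * |B - A| ≤ x ^ 2 * (K * v ^ 8 / x ^ 3 + K * v ^ 8 / x ^ 3) := by
          gcongr
          exact (abs_sub _ _).trans (add_le_add h2' h1)
      _ = K * v ^ 8 * (2 / x) := by field_simp; ring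
  refine (abs_add_le _ _).trans ((add_le_add (abs_add_le _ _) le_rfl).trans ?_)
  linarith

/-! ### Pointwise limit, domination, and passage to the limit. -/

theorem abs_exp_sub_exp_le {a b m : ℝ} (ha : a ≤ m) (hb : b ≤ m) :
    |Real.exp a - Real.exp b| ≤ |a - b| * Real.exp m := by
  wlog hab : b ≤ a generalizing a b
  · rw [abs_sub_comm, abs_sub_comm a]
    exact this hb ha (le_of_not_ge hab)
  rw [abs_of_nonneg (sub_nonneg.2 (Real.exp_le_exp.2 hab)), abs_of_nonneg (sub_nonneg.2 hab)]
  have h1 : Real.exp b = Real.exp a * Real.exp (b - a) := by rw [← Real.exp_add]; ring_nf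
  have h2 := Real.add_one_le_exp (b - a)
  have h3 := Real.exp_le_exp.2 ha
  calc Real.exp a - Real.exp b = Real.exp a * (1 - Real.exp (b - a)) := by rw [h1]; ring
    _ ≤ Real.exp a * (a - b) := mul_le_mul_of_nonneg_left (by linarith) (Real.exp_pos a).le
    _ ≤ Real.exp m * (a - b) := mul_le_mul_of_nonneg_right h3 (sub_nonneg.2 hab)
    _ = _ := mul_comm _ _

theorem tendsto_sq_mul_exp_sub {a : ℕ → ℝ} {l L : ℝ} (ha : Tendsto a atTop (𝓝 l))
    (hL : Tendsto (fun d : ℕ ↦ (d : ℝ) ^ 2 * (a (d + 1) - a d)) atTop (𝓝 L)) :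
    Tendsto (fun d : ℕ ↦ (d : ℝ) ^ 2 * (Real.exp (a (d + 1)) - Real.exp (a d))) atTop
      (𝓝 (L * Real.exp l)) := by
  have h0 : Tendsto (fun d ↦ a (d + 1) - a d) atTop (𝓝 0) := by
    simpa using (ha.comp (tendsto_add_atTop_nat 1)).sub ha
  have h1 : Tendsto (fun d ↦ dslope Real.exp 0 (a (d + 1) - a d)) atTop (𝓝 1) := by
    have h : ContinuousAt (dslope Real.exp 0) 0 :=
      continuousAt_dslope_same.2 Real.differentiableAt_exp
    have h' := h.tendsto.comp h0
    rwa [dslope_same, Real.deriv_exp, Real.exp_zero] at h'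
  have h2 := (hL.mul h1).mul ((Real.continuous_exp.tendsto l).comp ha)
  rw [mul_one] at h2
  refine h2.congr fun d ↦ ?_
  have h3 := sub_smul_dslope Real.exp 0 (a (d + 1) - a d)
  rw [sub_zero, smul_eq_mul, Real.exp_zero] at h3
  have h4 : Real.exp (a (d + 1)) = Real.exp (a (d + 1) - a d) * Real.exp (a d) := by
    rw [← Real.exp_add]; ring_nf
  rw [h4, Function.comp_apply, mul_assoc ((d : ℝ) ^ 2), h3]
  ring

/-- All but two factors are bounded by `31/32`; the last two supply the integrable decay in `v`. -/
theorem abs_sinc_pow_le_of_half_le {n : ℕ} (hn : 2 ≤ n) {v : ℝ} (hv : 1 / 2 ≤ |v / √n|) :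
    |Real.sinc (v / √n) ^ n| ≤ (31 / 32) ^ (n - 2) * (2 * n) * (1 + v ^ 2)⁻¹ := by
  have hn' : (2 : ℝ) ≤ n := by exact_mod_cast hn
  have h1 := sinc_sq_le (v / √n)
  rw [div_pow, Real.sq_sqrt (by linarith)] at h1
  have h2 : (1 + v ^ 2 / n)⁻¹ ≤ (n : ℝ) * (1 + v ^ 2)⁻¹ := by
    rw [← div_eq_mul_inv, inv_eq_one_div, div_le_div_iff₀ (by positivity) (by positivity)]
    have : (n : ℝ) * (1 + v ^ 2 / n) = n + v ^ 2 := by field_simp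
    rw [this]
    linarith
  have h3 (x : ℝ) : |x ^ n| = |x| ^ (n - 2) * x ^ 2 := by
    rw [abs_pow, ← sq_abs x, ← pow_add, Nat.sub_add_cancel hn]
  rw [h3]
  calc |Real.sinc (v / √n)| ^ (n - 2) * Real.sinc (v / √n) ^ 2
      ≤ (31 / 32) ^ (n - 2) * (2 * (n * (1 + v ^ 2)⁻¹)) := by
        gcongr
        · exact abs_sinc_le_of_half_le hv
        · linarith
    _ = _ := by ring

theorem exists_abs_sq_mul_sinc_pow_sub_le_far : ∃ C : ℝ, 0 ≤ C ∧ ∀ (d : ℕ) (v : ℝ), 2 ≤ d →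
    √d ≤ |v| → |(d : ℝ) ^ 2 * (Real.sinc (v / √(d + 1 : ℕ)) ^ (d + 1) - Real.sinc (v / √d) ^ d)| ≤
      C * (1 + v ^ 2)⁻¹ := by
  have hlim := tendsto_pow_const_mul_const_pow_of_abs_lt_one 3 (r := (31 / 32 : ℝ))
    (by norm_num [abs_of_pos])
  obtain ⟨C, hC⟩ := hlim.bddAbove_range
  have hC' (d : ℕ) : (d : ℝ) ^ 3 * (31 / 32) ^ d ≤ C := hC ⟨d, rfl⟩
  have hC0 : 0 ≤ C := by simpa using hC' 0
  refine ⟨16 * C, by positivity, fun d v hd hv ↦ ?_⟩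
  have hd' : (2 : ℝ) ≤ d := by exact_mod_cast hd
  have hpos : 0 < √(d : ℝ) := Real.sqrt_pos.2 (by linarith)
  have hpos' : 0 < √((d + 1 : ℕ) : ℝ) := Real.sqrt_pos.2 (by positivity)
  have h1 : 1 / 2 ≤ |v / √d| := by
    rw [abs_div, abs_of_pos hpos, le_div_iff₀ hpos]
    linarith
  have h2 : 1 / 2 ≤ |v / √(d + 1 : ℕ)| := by
    rw [abs_div, abs_of_pos hpos', le_div_iff₀ hpos']
    refine le_trans ?_ hv
    -- The threshold `1/2` leaves room for replacing `√d` by `√(d + 1)`.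
    have : √((d + 1 : ℕ) : ℝ) ≤ 2 * √d := by
      rw [show (2 : ℝ) * √d = √(2 ^ 2 * d) by
        rw [Real.sqrt_mul (by positivity), Real.sqrt_sq (by norm_num)]]
      apply Real.sqrt_le_sqrt
      push_cast
      linarith
    linarith
  have b1 := abs_sinc_pow_le_of_half_le hd h1
  have b2 := abs_sinc_pow_le_of_half_le (by omega) h2
  have b1' : |Real.sinc (v / √d) ^ d| ≤ (31 / 32) ^ (d - 2) * (4 * d) * (1 + v ^ 2)⁻¹ := by
    refine b1.trans ?_
    gcongr
    norm_num
  have b2' : |Real.sinc (v / √(d + 1 : ℕ)) ^ (d + 1)| ≤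
      (31 / 32) ^ (d - 2) * (4 * d) * (1 + v ^ 2)⁻¹ := by
    refine b2.trans ?_
    gcongr ?_ * ?_ * _
    · exact pow_le_pow_of_le_one (by norm_num) (by norm_num) (by omega)
    · push_cast
      linarith
  have hpow : ((31 : ℝ) / 32) ^ (d - 2) ≤ 2 * (31 / 32) ^ d := by
    nth_rewrite 2 [← Nat.sub_add_cancel hd]
    rw [pow_add]
    have : (0 : ℝ) ≤ (31 / 32) ^ (d - 2) := by positivity
    nlinarith
  rw [abs_mul, abs_of_nonneg (by positivity : (0 : ℝ) ≤ d ^ 2)]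
  calc (d : ℝ) ^ 2 * |Real.sinc (v / √(d + 1 : ℕ)) ^ (d + 1) - Real.sinc (v / √d) ^ d|
      ≤ (d : ℝ) ^ 2 * ((31 / 32) ^ (d - 2) * (4 * d) * (1 + v ^ 2)⁻¹ +
          (31 / 32) ^ (d - 2) * (4 * d) * (1 + v ^ 2)⁻¹) := by
        gcongr
        exact (abs_sub _ _).trans (add_le_add b2' b1')
    _ = 8 * (d : ℝ) ^ 3 * (31 / 32) ^ (d - 2) * (1 + v ^ 2)⁻¹ := by ring
    _ ≤ 8 * (d : ℝ) ^ 3 * (2 * (31 / 32) ^ d) * (1 + v ^ 2)⁻¹ := by gcongr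
    _ = 16 * ((d : ℝ) ^ 3 * (31 / 32) ^ d) * (1 + v ^ 2)⁻¹ := by ring
    _ ≤ 16 * C * (1 + v ^ 2)⁻¹ := by
        gcongr
        exact hC' d

theorem exists_abs_sq_mul_sinc_pow_sub_le_near : ∃ K : ℝ, 0 ≤ K ∧ ∀ (d : ℕ) (v : ℝ), 1 ≤ d →
    |v| ≤ √d → |(d : ℝ) ^ 2 * (Real.sinc (v / √(d + 1 : ℕ)) ^ (d + 1) - Real.sinc (v / √d) ^ d)| ≤
      3 * (v ^ 4 + v ^ 6 + K * v ^ 8) * Real.exp (-(1 / 8) * v ^ 2) := by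
  obtain ⟨K, hK0, hK⟩ := exists_abs_logSincPow_succ_sub_le
  refine ⟨K, hK0, fun d v hd hv ↦ ?_⟩
  have hd' : (1 : ℝ) ≤ d := by exact_mod_cast hd
  have hv' : |v| ≤ √(d + 1 : ℕ) := hv.trans (Real.sqrt_le_sqrt (by simp))
  have hv4 : 0 ≤ v ^ 4 := by positivity
  have hv6 : 0 ≤ v ^ 6 := by positivity
  have hv8 : 0 ≤ K * v ^ 8 := by positivity
  have h1 := hK d v hd hv
  have h2 : (v ^ 4 + v ^ 6 + K * v ^ 8) * (2 / d) ≤ (v ^ 4 + v ^ 6 + K * v ^ 8) * 2 := by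
    gcongr
    exact div_le_self (by norm_num) hd'
  -- The `3` absorbs the factor `2` from the error and the main term `v⁴/180`.
  have h3 : |(d : ℝ) ^ 2 * (logSincPow (d + 1) v - logSincPow d v)| ≤
      3 * (v ^ 4 + v ^ 6 + K * v ^ 8) := by
    rw [abs_le] at h1 ⊢
    constructor <;> linarith
  rw [sinc_pow_eq_exp hv, sinc_pow_eq_exp hv', abs_mul, abs_of_nonneg (by positivity)]
  have h4 := abs_exp_sub_exp_le (logSincPow_le (by omega) hv') (logSincPow_le hd hv)
  rw [abs_mul, abs_of_nonneg (by positivity)] at h3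
  calc (d : ℝ) ^ 2 * |Real.exp (logSincPow (d + 1) v) - Real.exp (logSincPow d v)|
      ≤ (d : ℝ) ^ 2 * (|logSincPow (d + 1) v - logSincPow d v| * Real.exp (-(v ^ 2 / 8))) := by
        gcongr
    _ = (d : ℝ) ^ 2 * |logSincPow (d + 1) v - logSincPow d v| * Real.exp (-(1 / 8) * v ^ 2) := by
        rw [← mul_assoc]
        congr 2
        ring
    _ ≤ _ := by gcongr

theorem eventually_abs_le_sqrt (v : ℝ) : ∀ᶠ d : ℕ in atTop, |v| ≤ √d :=
  (Real.tendsto_sqrt_atTop.comp tendsto_natCast_atTop_atTop).eventually_ge_atTop _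

theorem tendsto_sq_mul_sinc_pow_sub (v : ℝ) :
    Tendsto (fun d : ℕ ↦ (d : ℝ) ^ 2 *
      (Real.sinc (v / √(d + 1 : ℕ)) ^ (d + 1) - Real.sinc (v / √d) ^ d)) atTop
      (𝓝 (v ^ 4 / 180 * Real.exp (-(1 / 6) * v ^ 2))) := by
  have hev := (eventually_abs_le_sqrt v).and (eventually_ge_atTop 1)
  have hdiv (k : ℝ) : Tendsto (fun d : ℕ ↦ k / (d : ℝ)) atTop (𝓝 0) :=
    tendsto_const_div_atTop_nhds_zero_nat k
  have hinv : Tendsto (fun d : ℕ ↦ (1 : ℝ) / d) atTop (𝓝 0) := hdiv 1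
  have ha : Tendsto (fun d ↦ logSincPow d v) atTop (𝓝 (-(1 / 6) * v ^ 2)) := by
    obtain ⟨K, hK0, hK⟩ := exists_abs_logSincPow_add_le
    have h1 : Tendsto (fun d : ℕ ↦ logSincPow d v +
        (v ^ 2 / 6 + v ^ 4 / 180 / d + v ^ 6 / 2835 / d ^ 2)) atTop (𝓝 0) := by
      refine squeeze_zero_norm' (a := fun d : ℕ ↦ K * v ^ 8 / (d : ℝ) ^ 3) ?_ ?_
      · filter_upwards [hev] with d hd
        exact hK d v hd.2 hd.1
      · have := (hinv.pow 3).const_mul (K * v ^ 8)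
        simpa [div_eq_mul_inv] using this
    have h2 : Tendsto (fun d : ℕ ↦ v ^ 2 / 6 + v ^ 4 / 180 / d + v ^ 6 / 2835 / (d : ℝ) ^ 2) atTop
        (𝓝 (v ^ 2 / 6)) := by
      have := ((hdiv (v ^ 4 / 180)).const_add (v ^ 2 / 6)).add
        ((hinv.pow 2).const_mul (v ^ 6 / 2835))
      simpa [div_eq_mul_inv] using this
    have h3 := h1.sub h2
    rw [show 0 - v ^ 2 / 6 = -(1 / 6) * v ^ 2 by ring] at h3
    exact h3.congr fun d ↦ by ring
  have hL : Tendsto (fun d : ℕ ↦ (d : ℝ) ^ 2 * (logSincPow (d + 1) v - logSincPow d v)) atTop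
      (𝓝 (v ^ 4 / 180)) := by
    obtain ⟨K, hK0, hK⟩ := exists_abs_logSincPow_succ_sub_le
    rw [tendsto_iff_norm_sub_tendsto_zero]
    refine squeeze_zero' (g := fun d : ℕ ↦ (v ^ 4 + v ^ 6 + K * v ^ 8) * (2 / d))
      (Eventually.of_forall fun _ ↦ norm_nonneg _) ?_ ?_
    · filter_upwards [hev] with d hd
      exact hK d v hd.2 hd.1
    · simpa using (hdiv 2).const_mul (v ^ 4 + v ^ 6 + K * v ^ 8)
  refine (tendsto_sq_mul_exp_sub ha hL).congr' ?_
  filter_upwards [hev] with d hd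
  rw [sinc_pow_eq_exp hd.1, sinc_pow_eq_exp (hd.1.trans (Real.sqrt_le_sqrt (by simp)))]

theorem integrable_pow_mul_exp_neg_mul_sq {b : ℝ} (hb : 0 < b) (n : ℕ) :
    Integrable fun v : ℝ ↦ v ^ n * Real.exp (-b * v ^ 2) := by
  have := integrable_rpow_mul_exp_neg_mul_sq hb (s := n) (by linarith [(Nat.cast_nonneg n : (0:ℝ) ≤ n)])
  simpa using this

theorem tendsto_sq_mul_integral_sinc_pow_sub (t : ℝ) :
    Tendsto (fun d : ℕ ↦ (d : ℝ) ^ 2 *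
      ((∫ v : ℝ, Real.sinc (v / √(d + 1 : ℕ)) ^ (d + 1) * Real.cos (2 * t * v)) -
        ∫ v : ℝ, Real.sinc (v / √d) ^ d * Real.cos (2 * t * v))) atTop
      (𝓝 (∫ v : ℝ, v ^ 4 / 180 * Real.exp (-(1 / 6) * v ^ 2) * Real.cos (2 * t * v))) := by
  obtain ⟨C, hC0, hC⟩ := exists_abs_sq_mul_sinc_pow_sub_le_far
  obtain ⟨K, hK0, hK⟩ := exists_abs_sq_mul_sinc_pow_sub_le_near
  let G : ℕ → ℝ → ℝ := fun d v ↦ (d : ℝ) ^ 2 *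
    (Real.sinc (v / √(d + 1 : ℕ)) ^ (d + 1) - Real.sinc (v / √d) ^ d)
  have hlim : Tendsto (fun d ↦ ∫ v, G d v * Real.cos (2 * t * v)) atTop
      (𝓝 (∫ v : ℝ, v ^ 4 / 180 * Real.exp (-(1 / 6) * v ^ 2) * Real.cos (2 * t * v))) := by
    apply tendsto_integral_filter_of_dominated_convergence
      (bound := fun v ↦ 3 * (v ^ 4 + v ^ 6 + K * v ^ 8) * Real.exp (-(1 / 8) * v ^ 2) +
        C * (1 + v ^ 2)⁻¹)
    · refine Eventually.of_forall fun d ↦ Continuous.aestronglyMeasurable ?_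
      have := Real.continuous_sinc
      fun_prop
    · filter_upwards [eventually_ge_atTop 2] with d hd
      refine Eventually.of_forall fun v ↦ ?_
      rw [norm_mul]
      refine (mul_le_of_le_one_right (norm_nonneg _) (Real.abs_cos_le_one _)).trans ?_
      have p1 : 0 ≤ 3 * (v ^ 4 + v ^ 6 + K * v ^ 8) * Real.exp (-(1 / 8) * v ^ 2) := by positivity
      have p2 : 0 ≤ C * (1 + v ^ 2)⁻¹ := by positivity
      rcases le_total |v| √d with h | h
      · exact (hK d v (by omega) h).trans (by linarith)
      · exact (hC d v hd h).trans (by linarith)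
    · refine Integrable.add ?_ (integrable_inv_one_add_sq.const_mul C)
      have h (n) := integrable_pow_mul_exp_neg_mul_sq (b := 1 / 8) (by norm_num) n
      refine ((((h 4).add (h 6)).add ((h 8).const_mul K)).const_mul 3).congr
        (Eventually.of_forall fun v ↦ ?_)
      simp only [Pi.add_apply]
      ring
    · exact Eventually.of_forall fun v ↦ (tendsto_sq_mul_sinc_pow_sub v).mul_const _
  refine hlim.congr' ?_
  filter_upwards [eventually_ge_atTop 2] with d hd
  have hint {n : ℕ} (hn : 2 ≤ n) :
      Integrable fun v : ℝ ↦ Real.sinc (v / √n) ^ n * Real.cos (2 * t * v) := by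
    have hn' : (0 : ℝ) < n := by exact_mod_cast (by omega : 0 < n)
    have h := integrable_sinc_pow hn (a := (√n)⁻¹) (by positivity)
    exact h.mul_bdd (c := 1) (by fun_prop) (Eventually.of_forall fun v ↦ Real.abs_cos_le_one _)
  rw [← integral_sub (hint (by omega)) (hint hd), ← integral_const_mul]
  congr 1
  ext v
  simp only [G]
  ring

/-! ### The limiting Gaussian integral. -/

theorem integral_exp_neg_sq_mul_cos (t : ℝ) :
    ∫ v : ℝ, Real.exp (-(1 / 6) * v ^ 2) * Real.cos (2 * t * v) =
      √(6 * Real.pi) * Real.exp (-(6 * t ^ 2)) := by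
  have h := fourierIntegral_gaussian (b := 1 / 6) (by norm_num) (2 * t)
  have h1 (v : ℝ) : Complex.exp (Complex.I * (2 * t) * v) * Complex.exp (-(1 / 6) * v ^ 2) =
      (Real.exp (-(1 / 6) * v ^ 2) : ℂ) * Complex.exp (((2 * t * v : ℝ) : ℂ) * Complex.I) := by
    push_cast
    rw [mul_comm]
    congr 2
    ring
  have h2 : ((Real.pi : ℂ) / (1 / 6)) ^ (1 / 2 : ℂ) *
      Complex.exp (-(2 * t) ^ 2 / (4 * (1 / 6))) =
      ((√(6 * Real.pi) * Real.exp (-(6 * t ^ 2)) : ℝ) : ℂ) := by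
    rw [Real.sqrt_eq_rpow, Complex.ofReal_mul, Complex.ofReal_cpow (by positivity)]
    push_cast
    congr 2
    · ring
    · ring
  rw [h2] at h
  simp_rw [h1] at h
  have hint : Integrable fun v : ℝ ↦ (Real.exp (-(1 / 6) * v ^ 2) : ℂ) *
      Complex.exp (((2 * t * v : ℝ) : ℂ) * Complex.I) := by
    refine (integrable_exp_neg_mul_sq (b := 1 / 6) (by norm_num)).ofReal.mul_bdd (c := 1)
      (by fun_prop) (Eventually.of_forall fun v ↦ ?_)
    exact (Complex.norm_exp_ofReal_mul_I _).le
  have hre := congrArg Complex.re h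
  rw [← RCLike.re_eq_complex_re, ← integral_re hint] at hre
  simpa only [RCLike.re_eq_complex_re, Complex.re_ofReal_mul, Complex.exp_ofReal_mul_I_re,
    Complex.ofReal_re] using hre

theorem integral_pow_four_mul_exp_neg_sq_mul_cos (t : ℝ) :
    ∫ v : ℝ, v ^ 4 / 180 * Real.exp (-(1 / 6) * v ^ 2) * Real.cos (2 * t * v) =
      3 / 20 * (1 - 24 * t ^ 2 + 48 * t ^ 4) * (√(6 * Real.pi) * Real.exp (-(6 * t ^ 2))) := by
  have hc (n : ℕ) : Integrable fun v : ℝ ↦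
      v ^ n * Real.exp (-(1 / 6) * v ^ 2) * Real.cos (2 * t * v) :=
    (integrable_pow_mul_exp_neg_mul_sq (by norm_num) n).mul_bdd (c := 1) (by fun_prop)
      (Eventually.of_forall fun v ↦ Real.abs_cos_le_one _)
  have hs (n : ℕ) : Integrable fun v : ℝ ↦
      v ^ n * Real.exp (-(1 / 6) * v ^ 2) * Real.sin (2 * t * v) :=
    (integrable_pow_mul_exp_neg_mul_sq (by norm_num) n).mul_bdd (c := 1) (by fun_prop)
      (Eventually.of_forall fun v ↦ Real.abs_sin_le_one _)
  -- `P` and `Q` solve the linear system making `exp (-v²/6) (P cos + Q sin)` an antiderivative of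
  -- the integrand in `hzero`: the sine terms cancel, and the cosine coefficient is `v⁴` minus a
  -- constant. This reduces the fourth moment to the plain Gaussian transform.
  let P : ℝ → ℝ := fun v ↦ -3 * v ^ 3 + (108 * t ^ 2 - 27) * v
  let Q : ℝ → ℝ := fun v ↦ 18 * t * v ^ 2 + (270 * t - 648 * t ^ 3)
  have hzero : ∫ v : ℝ, (v ^ 4 - 27 * (1 - 24 * t ^ 2 + 48 * t ^ 4)) *
      Real.exp (-(1 / 6) * v ^ 2) * Real.cos (2 * t * v) = 0 := by
    apply integral_eq_zero_of_hasDerivAt_of_integrable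
      (f := fun v ↦ Real.exp (-(1 / 6) * v ^ 2) *
        (P v * Real.cos (2 * t * v) + Q v * Real.sin (2 * t * v)))
    · intro v
      have hlin : HasDerivAt (fun v : ℝ ↦ 2 * t * v) (2 * t) v := by
        simpa using (hasDerivAt_id v).const_mul (2 * t)
      have hP : HasDerivAt P (-3 * (3 * v ^ 2) + (108 * t ^ 2 - 27)) v :=
        (((hasDerivAt_pow 3 v).const_mul (-3)).add
          ((hasDerivAt_id v).const_mul (108 * t ^ 2 - 27))).congr_deriv (by norm_num)
      have hQ : HasDerivAt Q (18 * t * (2 * v)) v :=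
        (((hasDerivAt_pow 2 v).const_mul (18 * t)).add_const
          (270 * t - 648 * t ^ 3)).congr_deriv (by norm_num)
      have hE : HasDerivAt (fun v : ℝ ↦ Real.exp (-(1 / 6) * v ^ 2))
          (Real.exp (-(1 / 6) * v ^ 2) * (-(1 / 6) * (2 * v))) v :=
        ((hasDerivAt_pow 2 v).const_mul (-(1 / 6))).exp.congr_deriv (by norm_num)
      refine (hE.mul ((hP.mul hlin.cos).add (hQ.mul hlin.sin))).congr_deriv ?_
      simp only [P, Q, Pi.add_apply, Pi.mul_apply]
      ring
    · refine ((hc 4).sub ((hc 0).const_mul (27 * (1 - 24 * t ^ 2 + 48 * t ^ 4)))).congr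
        (Eventually.of_forall fun v ↦ ?_)
      simp only [Pi.sub_apply]
      ring
    · refine ((((hc 3).const_mul (-3)).add ((hc 1).const_mul (108 * t ^ 2 - 27))).add
        (((hs 2).const_mul (18 * t)).add ((hs 0).const_mul (270 * t - 648 * t ^ 3)))).congr
        (Eventually.of_forall fun v ↦ ?_)
      simp only [Pi.add_apply, P, Q]
      ring
  have hsplit : (fun v : ℝ ↦ v ^ 4 / 180 * Real.exp (-(1 / 6) * v ^ 2) * Real.cos (2 * t * v)) =
      fun v ↦ 1 / 180 * ((v ^ 4 - 27 * (1 - 24 * t ^ 2 + 48 * t ^ 4)) *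
        Real.exp (-(1 / 6) * v ^ 2) * Real.cos (2 * t * v)) +
        3 / 20 * (1 - 24 * t ^ 2 + 48 * t ^ 4) *
          (Real.exp (-(1 / 6) * v ^ 2) * Real.cos (2 * t * v)) := by
    ext v
    ring
  rw [hsplit, integral_add, integral_const_mul, integral_const_mul, hzero,
    integral_exp_neg_sq_mul_cos]
  · ring
  · refine (((hc 4).sub ((hc 0).const_mul (27 * (1 - 24 * t ^ 2 + 48 * t ^ 4)))).const_mul
      (1 / 180)).congr (Eventually.of_forall fun v ↦ ?_)
    simp only [Pi.sub_apply]
    ring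
  · exact ((hc 0).const_mul (3 / 20 * (1 - 24 * t ^ 2 + 48 * t ^ 4))).congr (Eventually.of_forall fun v ↦ by simp only [pow_zero, one_mul])

/-! ### Sign of the quartic and conclusion. -/

theorem gamma_quartic_eq (t : ℝ) :
    1 - 24 * t ^ 2 + 48 * t ^ 4 =
      48 * ((t ^ 2 - gammaMinus ^ 2) * (t ^ 2 - gammaPlus ^ 2)) := by
  have h0 : √(2 / 3 : ℝ) ^ 2 = 2 / 3 := Real.sq_sqrt (by norm_num)
  have h1 : √(2 / 3 : ℝ) ≤ 1 := Real.sqrt_le_one.2 (by norm_num)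
  have h2 := Real.sqrt_nonneg (2 / 3 : ℝ)
  rw [gammaMinus, gammaPlus, mul_pow, mul_pow, Real.sq_sqrt (by linarith),
    Real.sq_sqrt (by linarith)]
  linear_combination (3 : ℝ) * h0

theorem gammaMinus_nonneg : 0 ≤ gammaMinus := by
  unfold gammaMinus
  positivity

theorem gammaMinus_le_gammaPlus : gammaMinus ≤ gammaPlus := by
  unfold gammaMinus gammaPlus
  gcongr
  linarith [Real.sqrt_nonneg (2 / 3 : ℝ)]

theorem gamma_quartic_pos {t : ℝ} (ht : 0 ≤ t) (h : t < gammaMinus ∨ gammaPlus < t) :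
    0 < 1 - 24 * t ^ 2 + 48 * t ^ 4 := by
  have h1 := gammaMinus_nonneg
  have h2 := gammaMinus_le_gammaPlus
  rw [gamma_quartic_eq]
  refine mul_pos (by norm_num) ?_
  rcases h with h | h
  · exact mul_pos_of_neg_of_neg (by nlinarith) (by nlinarith)
  · exact mul_pos (by nlinarith) (by nlinarith)

theorem gamma_quartic_neg {t : ℝ} (h : gammaMinus < t ∧ t < gammaPlus) :
    1 - 24 * t ^ 2 + 48 * t ^ 4 < 0 := by
  have h1 := gammaMinus_nonneg
  rw [gamma_quartic_eq]
  refine mul_neg_of_pos_of_neg (by norm_num) (mul_neg_of_pos_of_neg ?_ ?_)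
  · nlinarith
  · nlinarith

theorem tendsto_sq_mul_sectionVolume_sub {t : ℝ}
    {H : (d : ℕ) → AffineSubspace ℝ (EuclideanSpace ℝ (Fin d))}
    (hH : ∀ d : ℕ, 1 ≤ d → IsDiagonalHyperplane t (H d)) :
    Tendsto
        (fun d : ℕ => (d : ℝ) ^ 2 * (sectionVolume (H (d + 1)) - sectionVolume (H d))) atTop
        (𝓝 (3 * √6 * (1 - 24 * t ^ 2 + 48 * t ^ 4)
          / (20 * √Real.pi * Real.exp (6 * t ^ 2)))) := by
  have h := (tendsto_sq_mul_integral_sinc_pow_sub t).const_mul Real.pi⁻¹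
  rw [integral_pow_four_mul_exp_neg_sq_mul_cos] at h
  have hlim : Real.pi⁻¹ * (3 / 20 * (1 - 24 * t ^ 2 + 48 * t ^ 4) *
      (√(6 * Real.pi) * Real.exp (-(6 * t ^ 2)))) =
      3 * √6 * (1 - 24 * t ^ 2 + 48 * t ^ 4) / (20 * √Real.pi * Real.exp (6 * t ^ 2)) := by
    have hpi : √Real.pi ^ 2 = Real.pi := Real.sq_sqrt Real.pi_pos.le
    have hpi0 : 0 < √Real.pi := Real.sqrt_pos.2 Real.pi_pos
    rw [Real.sqrt_mul (by norm_num), Real.exp_neg]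
    nth_rewrite 1 [← hpi]
    field_simp
  rw [hlim] at h
  refine h.congr' ?_
  filter_upwards [eventually_ge_atTop 2] with d hd
  rw [(hH d (by omega)).sectionVolume_eq_integral hd,
    (hH (d + 1) (by omega)).sectionVolume_eq_integral (by omega)]
  ring

theorem mainTheorem1 (t : ℝ) (ht : 0 ≤ t)
    (H : (d : ℕ) → AffineSubspace ℝ (EuclideanSpace ℝ (Fin d)))
    (hH : ∀ d : ℕ, 1 ≤ d → IsDiagonalHyperplane t (H d)) :
    Tendsto
        (fun d : ℕ => (d : ℝ) ^ 2 * (sectionVolume (H (d + 1)) - sectionVolume (H d))) atTop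
        (𝓝 (3 * √6 * (1 - 24 * t ^ 2 + 48 * t ^ 4)
          / (20 * √Real.pi * Real.exp (6 * t ^ 2)))) ∧
      (t < gammaMinus ∨ gammaPlus < t →
        ∀ᶠ d : ℕ in atTop, sectionVolume (H d) < sectionVolume (H (d + 1))) ∧
      (gammaMinus < t ∧ t < gammaPlus →
        ∀ᶠ d : ℕ in atTop, sectionVolume (H (d + 1)) < sectionVolume (H d)) := by
  have hlim := tendsto_sq_mul_sectionVolume_sub hH
  have hpi : 0 < √Real.pi := Real.sqrt_pos.2 Real.pi_pos
  refine ⟨hlim, fun h ↦ ?_, fun h ↦ ?_⟩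
  · have hpos := gamma_quartic_pos ht h
    filter_upwards [hlim.eventually_const_lt (by positivity)] with d hd
    exact sub_pos.1 (pos_of_mul_pos_right hd (by positivity))
  · have hneg := gamma_quartic_neg h
    have hlt : 3 * √6 * (1 - 24 * t ^ 2 + 48 * t ^ 4)
        / (20 * √Real.pi * Real.exp (6 * t ^ 2)) < 0 :=
      div_neg_of_neg_of_pos (mul_neg_of_pos_of_neg (by positivity) hneg) (by positivity)
    filter_upwards [hlim.eventually_lt_const hlt] with d hd
    exact sub_neg.1 (neg_of_mul_neg_right hd (by positivity))
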